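/- Let $K$ be a field, let $K[T]$ carry its canonical grading (the degree-$n$ part is $K\cdot T^n$, $n\in\mathbb{N}$), and let $M$ be a finitely generated $\mathbb{N}$-graded $K[T]$-module, i.e. a finitely generated $K[T]$-module that is the internal direct sum of additive subgroups $(M_n)_{n\in\mathbb{N}}$ with $(K\cdot T^n)\cdot M_m\subset M_{n+m}$ for all $n,m\in\mathbb{N}$. Then there exist $N\in\mathbb{N}$, $n_1,\dots,n_N\in\mathbb{N}$ and $k_1,\dots,k_N\in\mathbb{N}_{>0}\cup\{\infty\}$ and an isomorphism of graded $K[T]$-modules $$M\cong\bigoplus_{j=1}^N\Sigma^{n_j}\,K[T]/(T^{k_j}),$$ where $T^\infty:=0$, the right-hand side carries the canonical grading, $\Sigma^{n}$ denotes the upward shift of degrees by $n$ (so $(\Sigma^nL)_i=L_{i-n}$ for $i\ge n$ and $(\Sigma^nL)_i=0$ for $i<n$), and isomorphisms of graded modules are $K[T]$-linear isomorphisms that, together with their inverses, preserve degrees. Moreover, the multiset of all pairs $(n_j,k_j)$ with $j\in\{1,\dots,N\}$ is uniquely determined by $M$: any two such decompositions of $M$ give the same multiset (the barcode of $M$). 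-/

import Mathlib

open Polynomial DirectSum

namespace GradedMod

/-- The canonical grading on `K[T]`: the degree-`n` part consists of the monomials `a * T ^ n`. -/
noncomputable def canonicalGrading (K : Type*) [Field K] (n : ℕ) : AddSubgroup K[X] :=
  (monomial n : K →ₗ[K] K[X]).toAddMonoidHom.range

/-- A grading of the `R`-module `M` by additive subgroups: `M` is the internal direct sum of
the `𝓜 n`, and `𝓡 n • 𝓜 m ⊆ 𝓜 (n + m)`. Here `𝓡` is a grading of the ring `R`. -/
structure IsGradedModule {R : Type*} [CommRing R] (𝓡 : ℕ → AddSubgroup R)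
    {M : Type*} [AddCommGroup M] [Module R M] (𝓜 : ℕ → AddSubgroup M) : Prop where
  isInternal : DirectSum.IsInternal 𝓜
  smul_mem : ∀ {n m : ℕ} {r : R} {x : M}, r ∈ 𝓡 n → x ∈ 𝓜 m → r • x ∈ 𝓜 (n + m)

/-- The grading of the shift `Σ^d M`: degree `i` is `M_{i-d}` if `d ≤ i`, and `0` otherwise. -/
def shiftGrading {M : Type*} [AddCommGroup M] (d : ℕ) (𝓜 : ℕ → AddSubgroup M) (i : ℕ) :
    AddSubgroup M :=
  if d ≤ i then 𝓜 (i - d) else ⊥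

/-- The grading on the quotient `M ⧸ N`: degree `i` is `M_i / (N ∩ M_i)`, i.e. the image
of `M_i` in `M ⧸ N`. -/
def quotientGrading {R : Type*} [CommRing R] {M : Type*} [AddCommGroup M] [Module R M]
    (N : Submodule R M) (𝓜 : ℕ → AddSubgroup M) (i : ℕ) : AddSubgroup (M ⧸ N) :=
  (𝓜 i).map N.mkQ.toAddMonoidHom

/-- The grading on a direct sum: degree `i` is the direct sum of the degree-`i` parts. -/
def directSumGrading {ι : Type*} {M : ι → Type*} [∀ j, AddCommGroup (M j)]
    (𝓜 : ∀ j, ℕ → AddSubgroup (M j)) (i : ℕ) : AddSubgroup (⨁ j, M j) where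
  carrier := {x | ∀ j, x j ∈ 𝓜 j i}
  zero_mem' := fun j => (𝓜 j i).zero_mem
  add_mem' := fun hx hy j => (𝓜 j i).add_mem (hx j) (hy j)
  neg_mem' := fun hx j => (𝓜 j i).neg_mem (hx j)

/-- Isomorphisms of graded modules: linear isomorphisms that, like their inverses, preserve
degrees. -/
structure GradedIso {R : Type*} [CommRing R] {M N : Type*} [AddCommGroup M] [Module R M]
    [AddCommGroup N] [Module R N] (𝓜 : ℕ → AddSubgroup M) (𝓝 : ℕ → AddSubgroup N)
    extends M ≃ₗ[R] N where
  map_mem : ∀ {i : ℕ} {x : M}, x ∈ 𝓜 i → toLinearEquiv x ∈ 𝓝 i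
  symm_map_mem : ∀ {i : ℕ} {y : N}, y ∈ 𝓝 i → toLinearEquiv.symm y ∈ 𝓜 i

/-- `T ^ k` for `k ∈ ℕ ∪ {∞}`, where `T ^ ∞ = 0`. -/
noncomputable def powT (K : Type*) [Field K] : ℕ∞ → K[X]
  | some k => X ^ k
  | none => 0

/-- The cyclic module `K[T] / (T ^ k)`. -/
abbrev Cyclic (K : Type*) [Field K] (k : ℕ∞) : Type _ :=
  K[X] ⧸ Submodule.span K[X] {powT K k}

/-- The canonical grading on `Σ^d K[T] / (T ^ k)`. -/
noncomputable def cyclicGrading (K : Type*) [Field K] (d : ℕ) (k : ℕ∞) :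
    ℕ → AddSubgroup (Cyclic K k) :=
  shiftGrading d (quotientGrading (Submodule.span K[X] {powT K k}) (canonicalGrading K))

/-- The graded decompositions `M ≅ ⨁_{j=1}^N Σ^{d_j} K[T] / (T ^ {k_j})`. -/
abbrev GradedDecomposition (K : Type*) [Field K] {M : Type*} [AddCommGroup M] [Module K[X] M]
    (𝓜 : ℕ → AddSubgroup M) {N : ℕ} (d : Fin N → ℕ) (k : Fin N → ℕ∞) : Type _ :=
  GradedIso (R := K[X]) (N := ⨁ j, Cyclic K (k j)) 𝓜
    (directSumGrading fun j => cyclicGrading K (d j) (k j))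

/-- The multiset of all pairs `(d_j, k_j)`. -/
def barcode {N : ℕ} (d : Fin N → ℕ) (k : Fin N → ℕ∞) : Multiset (ℕ × ℕ∞) :=
  Finset.univ.val.map fun j => (d j, k j)

end GradedMod

/-! Existence: choose a homogeneous generating family with as few members as possible, fix its
degrees, and make its tuple of torsion orders minimal (`exists_generating_independent`). If a
homogeneous relation had a nonzero term, dividing it by the lowest power of `T` among its nonzero
terms would give a replacement for one generator with strictly smaller torsion order
(`exists_lt_of_relation`). So every homogeneous relation vanishes term by term, and the sum of the
cyclic modules maps isomorphically onto `M`.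

Uniqueness: the dimension of `T ^ p • M_i` is the number of bars alive from degree `i` to `i + p`,
hence an invariant of `M`. Differences of these numbers recover the multiplicity of each bar. -/

namespace GradedMod

/-! ### Homogeneous elements of the cyclic modules -/

section Cyclic

variable {K : Type*} [Field K]

theorem mem_span_powT {k : ℕ∞} {q : K[X]} :
    q ∈ Submodule.span K[X] {powT K k} ↔ ∀ a, q.coeff a ≠ 0 → k ≤ a := by
  rw [← Ideal.span, Ideal.mem_span_singleton]
  induction k using ENat.recTopCoe with
  | top =>
    change (0 : K[X]) ∣ q ↔ _
    simp [Polynomial.ext_iff]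
  | coe n =>
    change X ^ n ∣ q ↔ _
    simp only [X_pow_dvd_iff, Nat.cast_le]
    exact ⟨fun h a ha => not_lt.1 fun hlt => ha (h a hlt),
      fun h a hlt => by_contra fun ha => (h a ha).not_gt hlt⟩

theorem mk_monomial_eq_zero {k : ℕ∞} {a : ℕ} {c : K} :
    (Submodule.span K[X] {powT K k}).mkQ (monomial a c) = 0 ↔ c = 0 ∨ k ≤ a := by
  rw [Submodule.mkQ_apply, Submodule.Quotient.mk_eq_zero, mem_span_powT]
  constructor
  · intro h
    by_cases hc : c = 0
    · exact .inl hc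
    · exact .inr (h a (by simpa using hc))
  · rintro (rfl | h) b hb
    · simp at hb
    · rw [coeff_monomial] at hb
      split_ifs at hb with hab
      · exact hab ▸ h
      · exact absurd rfl hb

theorem mem_cyclicGrading {d i : ℕ} {k : ℕ∞} {y : Cyclic K k} :
    y ∈ cyclicGrading K d k i ↔
      ∃ c : K, (d ≤ i ∨ c = 0) ∧ (Submodule.span K[X] {powT K k}).mkQ (monomial (i - d) c) = y := by
  unfold cyclicGrading shiftGrading
  split_ifs with h
  · simp [quotientGrading, canonicalGrading, h]
  · rw [AddSubgroup.mem_bot]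
    constructor
    · rintro rfl
      exact ⟨0, .inr rfl, by simp⟩
    · rintro ⟨c, hc, rfl⟩
      simp [hc.resolve_left h]

end Cyclic

/-! ### Existence: generators with minimal torsion orders -/

section Existence

variable {K : Type*} [Field K] {M : Type*} [AddCommGroup M] [Module K[X] M]
  {𝓜 : ℕ → AddSubgroup M}

theorem IsGradedModule.monomial_smul_mem (h : IsGradedModule (canonicalGrading K) 𝓜)
    {d i a : ℕ} {x : M} (hx : x ∈ 𝓜 d) (hi : a + d = i) (c : K) : monomial a c • x ∈ 𝓜 i :=
  hi ▸ h.smul_mem ⟨c, rfl⟩ hx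

/-- Homogeneous components of a graded module, as additive endomorphisms. -/
theorem IsGradedModule.exists_component (h : IsGradedModule (canonicalGrading K) 𝓜) :
    ∃ π : ℕ → M →+ M, ∀ i (x : M) d, x ∈ 𝓜 d → π i x = if d = i then x else 0 := by
  classical
  let := h.isInternal.chooseDecomposition
  refine ⟨fun i => ((𝓜 i).subtype.comp (DFinsupp.evalAddMonoidHom i)).comp
    (decomposeAddEquiv 𝓜).toAddMonoidHom, fun i x d hx => ?_⟩
  change (decompose 𝓜 x i : M) = _
  split_ifs with hd
  · subst hd
    exact decompose_of_mem_same 𝓜 hx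
  · exact decompose_of_mem_ne 𝓜 hx hd

theorem IsGradedModule.component_smul (h : IsGradedModule (canonicalGrading K) 𝓜)
    {π : ℕ → M →+ M} (hπ : ∀ i (x : M) d, x ∈ 𝓜 d → π i x = if d = i then x else 0)
    (i : ℕ) {d : ℕ} {x : M} (hx : x ∈ 𝓜 d) (p : K[X]) :
    π i (p • x) = if d ≤ i then monomial (i - d) (p.coeff (i - d)) • x else 0 := by
  induction p using Polynomial.induction_on' with
  | add p q hp hq =>
    rw [add_smul, map_add, hp, hq]
    split_ifs
    · rw [coeff_add, map_add, add_smul]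
    · simp
  | monomial a c =>
    rw [hπ i _ _ (h.monomial_smul_mem hx rfl c)]
    by_cases hd : d ≤ i
    · rw [if_pos hd]
      by_cases ha : a + d = i
      · obtain rfl : a = i - d := by omega
        simp [ha]
      · rw [if_neg ha, coeff_monomial, if_neg (by omega)]
        simp
    · rw [if_neg hd, if_neg (by omega)]

/-- Homogeneous generating families of the degrees `d`. -/
structure IsHomogeneousGenerating (K : Type*) [Field K] {M : Type*} [AddCommGroup M]
    [Module K[X] M] (𝓜 : ℕ → AddSubgroup M) {n : ℕ} (d : Fin n → ℕ) (x : Fin n → M) : Prop where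
  mem : ∀ j, x j ∈ 𝓜 (d j)
  span_eq_top : Submodule.span K[X] (Set.range x) = ⊤

/-- `k` is the least exponent `a` with `T ^ a • x = 0`, or `∞` if there is none. -/
def IsTorsionOrder (K : Type*) [Field K] {M : Type*} [AddCommGroup M] [Module K[X] M]
    (x : M) (k : ℕ∞) : Prop :=
  ∀ a : ℕ, (X ^ a : K[X]) • x = 0 ↔ k ≤ a

theorem exists_isTorsionOrder (x : M) : ∃ k, IsTorsionOrder K x k := by
  classical
  by_cases h : ∃ a : ℕ, (X ^ a : K[X]) • x = 0
  · refine ⟨(Nat.find h : ℕ), fun a => ?_⟩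
    rw [Nat.cast_le]
    refine ⟨fun ha => Nat.find_min' h ha, fun ha => ?_⟩
    rw [← Nat.sub_add_cancel ha, pow_add, mul_smul, Nat.find_spec h, smul_zero]
  · push Not at h
    exact ⟨⊤, fun a => by simpa using h a⟩

theorem exists_isHomogeneousGenerating [Module.Finite K[X] M]
    (h : IsGradedModule (canonicalGrading K) 𝓜) :
    ∃ (n : ℕ) (d : Fin n → ℕ) (x : Fin n → M), IsHomogeneousGenerating K 𝓜 d x := by
  classical
  let := h.isInternal.chooseDecomposition
  set H : Set M := {x | ∃ i, x ∈ 𝓜 i}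
  have hH : Submodule.span K[X] H = ⊤ := by
    refine eq_top_iff.2 fun x _ => ?_
    rw [← sum_support_decompose 𝓜 x]
    exact Submodule.sum_mem _ fun i _ => Submodule.subset_span ⟨i, (decompose 𝓜 x i).2⟩
  obtain ⟨s, hs, hspan⟩ := (Submodule.fg_span_iff_fg_span_finset_subset H).1
    (hH ▸ Module.Finite.fg_top)
  choose d hd using fun y : s => hs y.2
  refine ⟨s.card, fun j => d (s.equivFin.symm j), fun j => (s.equivFin.symm j : M),
    fun j => hd _, ?_⟩
  rw [← hH, hspan]
  congr 1
  ext y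
  constructor
  · rintro ⟨j, rfl⟩
    exact (s.equivFin.symm j).2
  · intro hy
    exact ⟨s.equivFin ⟨y, hy⟩, by simp⟩

/-- A zero generator could be dropped. This is what makes all bar lengths positive. -/
theorem IsHomogeneousGenerating.ne_zero_of_minimal {n : ℕ}
    (hmin : ∀ m < n, ¬ ∃ (d : Fin m → ℕ) (x : Fin m → M), IsHomogeneousGenerating K 𝓜 d x)
    {d : Fin n → ℕ} {x : Fin n → M} (hx : IsHomogeneousGenerating K 𝓜 d x) (j : Fin n) :
    x j ≠ 0 := by
  intro hj
  obtain _ | n := n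
  · exact j.elim0
  refine hmin n n.lt_succ_self ⟨d ∘ j.succAbove, x ∘ j.succAbove, fun i => hx.mem _, ?_⟩
  rw [eq_top_iff, ← hx.span_eq_top, Submodule.span_le]
  rintro _ ⟨i, rfl⟩
  rcases Fin.eq_self_or_eq_succAbove j i with rfl | ⟨i, rfl⟩
  · rw [hj]
    exact Submodule.zero_mem _
  · exact Submodule.subset_span ⟨i, rfl⟩

/-- A homogeneous relation with a nonzero term lets one replace a generator by another one of the
same degree and smaller torsion order. -/
theorem IsHomogeneousGenerating.exists_lt_of_relation
    (h : IsGradedModule (canonicalGrading K) 𝓜) {n : ℕ} {d : Fin n → ℕ} {x : Fin n → M}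
    (hx : IsHomogeneousGenerating K 𝓜 d x) {k : Fin n → ℕ∞}
    (hk : ∀ j, IsTorsionOrder K (x j) (k j)) (D : ℕ) (a : Fin n → ℕ) (c : Fin n → K)
    (hD : ∀ j, c j ≠ 0 → a j + d j = D) (hrel : ∑ j, monomial (a j) (c j) • x j = 0)
    (hne : ∃ j, monomial (a j) (c j) • x j ≠ 0) :
    ∃ (x' : Fin n → M) (k' : Fin n → ℕ∞), IsHomogeneousGenerating K 𝓜 d x' ∧
      (∀ j, IsTorsionOrder K (x' j) (k' j)) ∧ k' < k := by
  classical
  set J : Finset (Fin n) := Finset.univ.filter fun j => monomial (a j) (c j) • x j ≠ 0 with hJ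
  have hJc : ∀ j ∈ J, c j ≠ 0 := by
    intro j hj hc
    simp [hJ, hc] at hj
  -- With the least exponent at `j₀`, the power `T ^ a j₀` divides every nonzero term.
  obtain ⟨j₀, hj₀, hmin⟩ := J.exists_min_image a (by
    obtain ⟨j, hj⟩ := hne
    exact ⟨j, by simp [hJ, hj]⟩)
  have hc₀ := hJc _ hj₀
  -- The relation divided by `c j₀ * T ^ a j₀`: the coefficient of `x j₀` is `1`, so `x j₀` can be
  -- recovered from `y` and the other generators.
  set y : M := ∑ j ∈ J, monomial (a j - a j₀) (c j / c j₀) • x j with hy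
  have hymem : y ∈ 𝓜 (d j₀) := by
    refine AddSubgroup.sum_mem _ fun j hj => h.monomial_smul_mem (hx.mem j) ?_ _
    have h1 := hD _ (hJc j hj)
    have h2 := hD _ hc₀
    have h3 := hmin j hj
    omega
  have hyzero : (X ^ a j₀ : K[X]) • y = 0 := by
    have hsum : ∑ j ∈ J, monomial (a j) (c j) • x j = 0 := by
      rw [hJ, Finset.sum_filter_ne_zero, hrel]
    calc (X ^ a j₀ : K[X]) • y
        = (C (c j₀)⁻¹ : K[X]) • ∑ j ∈ J, monomial (a j) (c j) • x j := by
          rw [hy, Finset.smul_sum, Finset.smul_sum]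
          refine Finset.sum_congr rfl fun j hj => ?_
          rw [smul_smul, smul_smul, X_pow_mul_monomial, C_mul_monomial,
            Nat.sub_add_cancel (hmin j hj), div_eq_inv_mul]
      _ = 0 := by rw [hsum, smul_zero]
  obtain ⟨l, hl⟩ := exists_isTorsionOrder (K := K) y
  have hlt : l < k j₀ := by
    refine ((hl _).1 hyzero).trans_lt (not_le.1 fun hle => ?_)
    have hzero := (hk j₀ _).2 hle
    refine (Finset.mem_filter.1 hj₀).2 ?_
    rw [← C_mul_X_pow_eq_monomial, mul_smul, hzero, smul_zero]
  refine ⟨Function.update x j₀ y, Function.update k j₀ l, ⟨fun j => ?_, ?_⟩, fun j => ?_, ?_⟩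
  · rcases eq_or_ne j j₀ with rfl | hj
    · simpa using hymem
    · simpa [hj] using hx.mem j
  · set S := Submodule.span K[X] (Set.range (Function.update x j₀ y))
    have hne : ∀ j ≠ j₀, x j ∈ S := fun j hj => Submodule.subset_span ⟨j, by simp [hj]⟩
    have hyS : y ∈ S := Submodule.subset_span ⟨j₀, by simp⟩
    rw [eq_top_iff, ← hx.span_eq_top, Submodule.span_le]
    rintro _ ⟨j, rfl⟩
    rcases eq_or_ne j j₀ with rfl | hj
    · rw [hy, ← Finset.add_sum_erase _ _ hj₀, Nat.sub_self, div_self hc₀, monomial_zero_one,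
        one_smul] at hyS
      exact (Submodule.add_mem_iff_left _ (Submodule.sum_mem _ fun i hi =>
        S.smul_mem _ (hne i (Finset.ne_of_mem_erase hi)))).1 hyS
    · exact hne j hj
  · rcases eq_or_ne j j₀ with rfl | hj
    · simpa using hl
    · simpa [hj] using hk j
  · exact update_lt_self_iff.2 hlt

theorem exists_generating_independent [Module.Finite K[X] M]
    (h : IsGradedModule (canonicalGrading K) 𝓜) :
    ∃ (n : ℕ) (d : Fin n → ℕ) (x : Fin n → M) (k : Fin n → ℕ∞),
      IsHomogeneousGenerating K 𝓜 d x ∧ (∀ j, IsTorsionOrder K (x j) (k j)) ∧ (∀ j, 0 < k j) ∧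
      ∀ (D : ℕ) (a : Fin n → ℕ) (c : Fin n → K), (∀ j, c j ≠ 0 → a j + d j = D) →
        ∑ j, monomial (a j) (c j) • x j = 0 → ∀ j, monomial (a j) (c j) • x j = 0 := by
  classical
  have hex := exists_isHomogeneousGenerating h
  obtain ⟨d, x₀, hx₀⟩ := Nat.find_spec hex
  have hmin := fun m (hm : m < Nat.find hex) => Nat.find_min hex hm
  let S : Set (Fin (Nat.find hex) → ℕ∞) := {k | ∃ x : Fin (Nat.find hex) → M,
    IsHomogeneousGenerating K 𝓜 d x ∧ ∀ j, IsTorsionOrder K (x j) (k j)}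
  have hS : S.Nonempty := by
    choose k hk using fun j => exists_isTorsionOrder (K := K) (x₀ j)
    exact ⟨k, x₀, hx₀, hk⟩
  -- The product order on tuples is well-founded because there are finitely many indices.
  obtain ⟨k, ⟨x, hx, hk⟩, hkmin⟩ := wellFounded_lt.has_min S hS
  refine ⟨_, d, x, k, hx, hk, fun j => ?_, fun D a c hD hrel => ?_⟩
  · refine pos_iff_ne_zero.2 fun h0 => hx.ne_zero_of_minimal hmin j ?_
    simpa using (hk j 0).2 (by simp [h0])
  · by_contra! hne
    obtain ⟨x', k', hx', hk', hlt⟩ := hx.exists_lt_of_relation h hk D a c hD hrel hne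
    exact hkmin k' ⟨x', hx', hk'⟩ hlt

theorem exists_gradedDecomposition [Module.Finite K[X] M]
    (h : IsGradedModule (canonicalGrading K) 𝓜) :
    ∃ (N : ℕ) (d : Fin N → ℕ) (k : Fin N → ℕ∞),
      (∀ j, 0 < k j) ∧ Nonempty (GradedDecomposition K 𝓜 d k) := by
  classical
  obtain ⟨n, d, x, k, hx, hk, hpos, hind⟩ := exists_generating_independent h
  obtain ⟨π, hπ⟩ := h.exists_component
  refine ⟨n, d, k, hpos, ?_⟩
  have hker : ∀ j, Submodule.span K[X] {powT K (k j)} ≤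
      LinearMap.ker (LinearMap.toSpanSingleton K[X] M (x j)) := by
    intro j
    rw [Submodule.span_singleton_le_iff_mem, LinearMap.mem_ker, LinearMap.toSpanSingleton_apply]
    cases hkj : k j with
    | top => exact zero_smul _ _
    | coe a => exact (hk j a).2 hkj.le
  let f : ∀ j, Cyclic K (k j) →ₗ[K[X]] M := fun j => Submodule.liftQ _ _ (hker j)
  let F : (⨁ j, Cyclic K (k j)) →ₗ[K[X]] M := toModule K[X] (Fin n) M f
  have hfmk : ∀ j p, f j (Submodule.mkQ _ p) = p • x j := fun j p => rfl
  have hFsum : ∀ y, F y = ∑ j, f j (y j) := by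
    intro y
    refine (congrArg F (sum_univ_of y).symm).trans ((map_sum F.toAddMonoidHom _ _).trans ?_)
    exact Finset.sum_congr rfl fun j _ => toModule_lof _ _ _
  -- For `d j > i` the truncated `i - d j` is `0`, so the coefficient must be set to `0` explicitly.
  have hcomp : ∀ (i : ℕ) (p : Fin n → K[X]), π i (∑ j, p j • x j) =
      ∑ j, monomial (i - d j) (if d j ≤ i then (p j).coeff (i - d j) else 0) • x j := by
    intro i p
    rw [map_sum]
    refine Finset.sum_congr rfl fun j _ => ?_
    rw [h.component_smul hπ i (hx.mem j)]
    split_ifs <;> simp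
  have hinj : Function.Injective F := by
    suffices hzero : ∀ y, F y = 0 → y = 0 by
      refine fun y z hyz => sub_eq_zero.1 (hzero _ ?_)
      rw [hFsum, hFsum] at hyz
      simp_rw [hFsum, DirectSum.sub_apply, map_sub, Finset.sum_sub_distrib]
      exact sub_eq_zero.2 hyz
    intro y hy
    choose p hp using fun j => Submodule.mkQ_surjective _ (y j)
    rw [hFsum] at hy
    simp_rw [← hp, hfmk] at hy
    refine DFinsupp.ext fun j => ?_
    rw [← hp j]
    refine (Submodule.Quotient.mk_eq_zero _).2 (mem_span_powT.2 fun a ha => (hk j a).1 ?_)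
    -- In degree `a + d j` the `j`-th term involves exactly the coefficient of `T ^ a` in `p j`.
    have hrel := hcomp (a + d j) p
    rw [hy, map_zero] at hrel
    have hj := hind (a + d j) _ _ (fun i hi => ?_) hrel.symm j
    · rw [if_pos (Nat.le_add_left _ _), Nat.add_sub_cancel, ← C_mul_X_pow_eq_monomial,
        mul_smul] at hj
      have := congrArg (fun z => C ((p j).coeff a)⁻¹ • z) hj
      simpa [smul_smul, ← mul_assoc, ← C_mul, inv_mul_cancel₀ ha] using this
    · have : d i ≤ a + d j := by
        by_contra hlt
        exact hi (if_neg hlt)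
      omega
  have hsurj : Function.Surjective F := by
    rw [← LinearMap.range_eq_top, eq_top_iff, ← hx.span_eq_top, Submodule.span_le]
    rintro _ ⟨j, rfl⟩
    refine ⟨lof K[X] (Fin n) _ j (Submodule.mkQ _ 1), ?_⟩
    rw [toModule_lof, hfmk, one_smul]
  have hmem : ∀ i y, y ∈ directSumGrading (fun j => cyclicGrading K (d j) (k j)) i →
      F y ∈ 𝓜 i := by
    intro i y hy
    rw [hFsum]
    refine AddSubgroup.sum_mem _ fun j _ => ?_
    obtain ⟨c, hc, hcy⟩ := mem_cyclicGrading.1 (hy j)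
    rw [← hcy, hfmk]
    rcases hc with hc | rfl
    · exact h.monomial_smul_mem (hx.mem j) (Nat.sub_add_cancel hc) c
    · simp
  have hlift : ∀ i z, z ∈ 𝓜 i →
      ∃ y ∈ directSumGrading (fun j => cyclicGrading K (d j) (k j)) i, F y = z := by
    intro i z hz
    obtain ⟨y, rfl⟩ := hsurj z
    choose p hp using fun j => Submodule.mkQ_surjective _ (y j)
    -- The degree-`i` part of the chosen preimage has the same image, since `z` is homogeneous.
    let y' : ⨁ j, Cyclic K (k j) := (linearEquivFunOnFintype K[X] (Fin n) _).symm fun j =>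
      Submodule.mkQ _ (monomial (i - d j) (if d j ≤ i then (p j).coeff (i - d j) else 0))
    have hy' : ∀ j, y' j = Submodule.mkQ _
        (monomial (i - d j) (if d j ≤ i then (p j).coeff (i - d j) else 0)) := fun j => rfl
    refine ⟨y', fun j => mem_cyclicGrading.2 ⟨_, ?_, (hy' j).symm⟩, ?_⟩
    · by_cases hd : d j ≤ i
      · exact .inl hd
      · exact .inr (if_neg hd)
    · have hpi := hπ i _ i hz
      rw [if_pos rfl] at hpi
      rw [← hpi, hFsum, hFsum]
      simp_rw [← hp, hy', hfmk]
      exact (hcomp i p).symm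
  let e := LinearEquiv.ofBijective F ⟨hinj, hsurj⟩
  refine ⟨⟨e.symm, fun {i z} hz => ?_, fun {i y} hy => hmem i y hy⟩⟩
  obtain ⟨y, hy, rfl⟩ := hlift i z hz
  have : e.symm (F y) = y := e.symm_apply_apply y
  rwa [this]

end Existence

/-! ### Uniqueness: counting bars by ranks of powers of `T` -/

section Uniqueness

variable {K : Type*} [Field K]

/-- The indices of the bars that are born by degree `i` and still alive in degree `i + p`. -/
def aliveBars {N : ℕ} (d : Fin N → ℕ) (k : Fin N → ℕ∞) (i p : ℕ) : Finset (Fin N) :=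
  Finset.univ.filter fun j => d j ≤ i ∧ ((i - d j + p : ℕ) : ℕ∞) < k j

/-- The parametrization of `T ^ p` times the degree-`i` part of `⨁ j, Σ^{d j} K[T] / (T ^ k j)`
by the coefficients at the bars that are alive from `i` to `i + p`. -/
noncomputable def aliveMap (K : Type*) [Field K] {N : ℕ} (d : Fin N → ℕ) (k : Fin N → ℕ∞)
    (i p : ℕ) : (aliveBars d k i p → K) →ₗ[K] ⨁ j, Cyclic K (k j) :=
  (linearEquivFunOnFintype K (Fin N) fun j => Cyclic K (k j)).symm.toLinearMap ∘ₗ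
    LinearMap.pi fun j => if h : j ∈ aliveBars d k i p then
      ((Submodule.mkQ _).restrictScalars K ∘ₗ monomial (i - d j + p)) ∘ₗ LinearMap.proj ⟨j, h⟩
    else 0

theorem aliveMap_apply_of_mem {N : ℕ} {d : Fin N → ℕ} {k : Fin N → ℕ∞} {i p : ℕ}
    (c : aliveBars d k i p → K) {j : Fin N} (h : j ∈ aliveBars d k i p) :
    aliveMap K d k i p c j = Submodule.mkQ _ (monomial (i - d j + p) (c ⟨j, h⟩)) := by
  change (if h : j ∈ aliveBars d k i p then
      ((Submodule.mkQ _).restrictScalars K ∘ₗ monomial (i - d j + p)) ∘ₗ LinearMap.proj ⟨j, h⟩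
    else 0 : (aliveBars d k i p → K) →ₗ[K] Cyclic K (k j)) c = _
  rw [dif_pos h]
  rfl

theorem aliveMap_apply_of_notMem {N : ℕ} {d : Fin N → ℕ} {k : Fin N → ℕ∞} {i p : ℕ}
    (c : aliveBars d k i p → K) {j : Fin N} (h : j ∉ aliveBars d k i p) :
    aliveMap K d k i p c j = 0 := by
  change (if h : j ∈ aliveBars d k i p then
      ((Submodule.mkQ _).restrictScalars K ∘ₗ monomial (i - d j + p)) ∘ₗ LinearMap.proj ⟨j, h⟩
    else 0 : (aliveBars d k i p → K) →ₗ[K] Cyclic K (k j)) c = _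
  rw [dif_neg h]
  rfl

theorem aliveMap_injective {N : ℕ} (d : Fin N → ℕ) (k : Fin N → ℕ∞) (i p : ℕ) :
    Function.Injective (aliveMap K d k i p) := by
  refine (injective_iff_map_eq_zero _).2 fun c hc => funext fun ⟨j, hj⟩ => ?_
  have h := aliveMap_apply_of_mem c hj
  rw [hc] at h
  exact (mk_monomial_eq_zero.1 h.symm).resolve_right (Finset.mem_filter.1 hj).2.2.not_ge

/-- Multiplication by `T ^ p` takes the degree-`i` monomial of bar `j` to exponent `i - d j + p`,
which is nonzero in the quotient exactly below `k j`. -/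
theorem mem_range_aliveMap {N : ℕ} {d : Fin N → ℕ} {k : Fin N → ℕ∞} {i p : ℕ}
    {z : ⨁ j, Cyclic K (k j)} :
    z ∈ LinearMap.range (aliveMap K d k i p) ↔
      ∃ y ∈ directSumGrading (fun j => cyclicGrading K (d j) (k j)) i, (X ^ p : K[X]) • y = z := by
  constructor
  · rintro ⟨c, rfl⟩
    let y : ⨁ j, Cyclic K (k j) := (linearEquivFunOnFintype K[X] (Fin N) _).symm fun j =>
      if h : j ∈ aliveBars d k i p then Submodule.mkQ _ (monomial (i - d j) (c ⟨j, h⟩)) else 0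
    have hy : ∀ j, y j = if h : j ∈ aliveBars d k i p then
      Submodule.mkQ _ (monomial (i - d j) (c ⟨j, h⟩)) else 0 := fun j => rfl
    refine ⟨y, fun j => ?_, DFinsupp.ext fun j => ?_⟩
    · rw [hy]
      split_ifs with h
      · exact mem_cyclicGrading.2 ⟨_, .inl (Finset.mem_filter.1 h).2.1, rfl⟩
      · exact AddSubgroup.zero_mem _
    · change (X ^ p : K[X]) • y j = _
      rw [hy]
      split_ifs with h
      · rw [aliveMap_apply_of_mem c h, ← map_smul, smul_eq_mul, X_pow_mul_monomial]
      · rw [aliveMap_apply_of_notMem c h, smul_zero]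
  · rintro ⟨y, hy, rfl⟩
    choose c hc hcy using fun j => mem_cyclicGrading.1 (hy j)
    refine ⟨fun j => c j, DFinsupp.ext fun j => ?_⟩
    change _ = (X ^ p : K[X]) • y j
    rw [← hcy, ← map_smul, smul_eq_mul, X_pow_mul_monomial]
    by_cases h : j ∈ aliveBars d k i p
    · rw [aliveMap_apply_of_mem _ h]
    · rw [aliveMap_apply_of_notMem _ h, eq_comm, mk_monomial_eq_zero]
      by_cases hd : d j ≤ i
      · refine .inr (not_lt.1 fun hlt => h ?_)
        simpa [aliveBars] using ⟨hd, hlt⟩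
      · exact .inl ((hc j).resolve_left hd)

/-- The isomorphism commutes with `T ^ p`, so it embeds one range of `aliveMap` into the other over
`K`. -/
theorem card_aliveBars_le {N N' : ℕ} {d : Fin N → ℕ} {k : Fin N → ℕ∞}
    {d' : Fin N' → ℕ} {k' : Fin N' → ℕ∞}
    (e : (⨁ j, Cyclic K (k j)) ≃ₗ[K[X]] ⨁ j, Cyclic K (k' j))
    (he : ∀ i y, y ∈ directSumGrading (fun j => cyclicGrading K (d j) (k j)) i →
      e y ∈ directSumGrading (fun j => cyclicGrading K (d' j) (k' j)) i) (i p : ℕ) :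
    (aliveBars d k i p).card ≤ (aliveBars d' k' i p).card := by
  let φ := (e.toLinearMap.restrictScalars K) ∘ₗ aliveMap K d k i p
  have hle : LinearMap.range φ ≤ LinearMap.range (aliveMap K d' k' i p) := by
    rintro _ ⟨c, rfl⟩
    obtain ⟨y, hy, hyc⟩ := mem_range_aliveMap.1 ⟨c, rfl⟩
    refine mem_range_aliveMap.2 ⟨e y, he i y hy, ?_⟩
    rw [← map_smul, hyc]
    rfl
  have hφ : Function.Injective φ := fun c c' hc =>
    aliveMap_injective d k i p (e.injective hc)
  have h := Submodule.finrank_mono hle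
  rwa [LinearMap.finrank_range_of_inj hφ,
    LinearMap.finrank_range_of_inj (aliveMap_injective d' k' i p), Module.finrank_fintype_fun_eq_card,
    Module.finrank_fintype_fun_eq_card, Fintype.card_coe, Fintype.card_coe] at h

/-- The number of bars that are born in degree `i` and are longer than `p`. -/
def bornCard {N : ℕ} (d : Fin N → ℕ) (k : Fin N → ℕ∞) (i p : ℕ) : ℕ :=
  (Finset.univ.filter fun j => d j = i ∧ (p : ℕ∞) < k j).card

theorem bornCard_zero {N : ℕ} (d : Fin N → ℕ) (k : Fin N → ℕ∞) (p : ℕ) :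
    bornCard d k 0 p = (aliveBars d k 0 p).card := by
  unfold bornCard aliveBars
  congr 1
  ext j
  simp

/-- A bar already born by degree `i` needs one more step to survive to `i + 1 + p`; the remaining
ones are born in degree `i + 1`. -/
theorem card_aliveBars_succ {N : ℕ} (d : Fin N → ℕ) (k : Fin N → ℕ∞) (i p : ℕ) :
    (aliveBars d k (i + 1) p).card =
      (aliveBars d k i (p + 1)).card + bornCard d k (i + 1) p := by
  classical
  unfold bornCard aliveBars
  rw [← Finset.card_union_of_disjoint]
  · congr 1
    ext j
    simp only [Finset.mem_filter, Finset.mem_univ, true_and, Finset.mem_union]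
    rcases lt_trichotomy (d j) (i + 1) with h | h | h
    · rw [show i + 1 - d j + p = i - d j + (p + 1) by omega]
      simp [h.le, h.ne, Nat.lt_succ_iff.1 h]
    · simp [h]
    · simp [h.not_ge, h.ne', (Nat.lt_of_succ_lt h).not_ge]
  · rw [Finset.disjoint_left]
    intro j h1 h2
    simp only [Finset.mem_filter, Finset.mem_univ, true_and] at h1 h2
    omega

theorem bornCard_eq_of_card_aliveBars_eq {N N' : ℕ} {d : Fin N → ℕ} {k : Fin N → ℕ∞}
    {d' : Fin N' → ℕ} {k' : Fin N' → ℕ∞}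
    (h : ∀ i p, (aliveBars d k i p).card = (aliveBars d' k' i p).card) (i p : ℕ) :
    bornCard d k i p = bornCard d' k' i p := by
  cases i with
  | zero => rw [bornCard_zero, bornCard_zero, h]
  | succ i =>
    have h1 := card_aliveBars_succ d k i p
    have h2 := card_aliveBars_succ d' k' i p
    rw [h, h] at h1
    omega

theorem count_barcode {N : ℕ} (d : Fin N → ℕ) (k : Fin N → ℕ∞) (i : ℕ) (l : ℕ∞) :
    (barcode d k).count (i, l) = (Finset.univ.filter fun j => d j = i ∧ k j = l).card := by
  rw [barcode, Multiset.count_map, Finset.card, Finset.filter_val]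
  congr 2
  ext j
  simp [eq_comm]

theorem bornCard_eq_count_add {N : ℕ} (d : Fin N → ℕ) (k : Fin N → ℕ∞) (i p : ℕ) :
    bornCard d k i p = (barcode d k).count (i, (p : ℕ∞) + 1) + bornCard d k i (p + 1) := by
  classical
  rw [count_barcode]
  unfold bornCard
  rw [← Finset.card_union_of_disjoint]
  · congr 1
    ext j
    simp only [Finset.mem_filter, Finset.mem_univ, true_and, Finset.mem_union, ← and_or_left,
      Nat.cast_add, Nat.cast_one]
    rw [← Order.add_one_le_iff_of_not_isMax (by simp), le_iff_eq_or_lt,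
      eq_comm (a := k j)]
  · rw [Finset.disjoint_left]
    intro j h1 h2
    simp only [Finset.mem_filter, Finset.mem_univ, true_and] at h1 h2
    rw [h1.2] at h2
    exact absurd h2.2 (by simp)

theorem exists_bornCard_eq_count_top {N : ℕ} (d : Fin N → ℕ) (k : Fin N → ℕ∞) :
    ∃ P : ℕ, ∀ p ≥ P, ∀ i, bornCard d k i p = (barcode d k).count (i, ⊤) := by
  -- The largest finite length; `toNat` sends `∞` to `0`, so infinite bars do not affect it.
  refine ⟨Finset.univ.sup fun j => (k j).toNat, fun p hp i => ?_⟩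
  rw [count_barcode]
  unfold bornCard
  congr 1
  ext j
  simp only [Finset.mem_filter, Finset.mem_univ, true_and]
  refine and_congr_right fun _ => ⟨fun h => by_contra fun hj => ?_, fun h => by simp [h]⟩
  have hle : (k j).toNat ≤ p :=
    (Finset.le_sup (f := fun j => (k j).toNat) (Finset.mem_univ j)).trans hp
  rw [← ENat.natCast_toNat hj, Nat.cast_lt] at h
  omega

theorem barcode_eq_of_bornCard_eq {N N' : ℕ} {d : Fin N → ℕ} {k : Fin N → ℕ∞}
    {d' : Fin N' → ℕ} {k' : Fin N' → ℕ∞} (hk : ∀ j, 0 < k j) (hk' : ∀ j, 0 < k' j)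
    (h : ∀ i p, bornCard d k i p = bornCard d' k' i p) : barcode d k = barcode d' k' := by
  classical
  refine Multiset.ext.2 fun ⟨i, l⟩ => ?_
  induction l using ENat.recTopCoe with
  | top =>
    obtain ⟨P, hP⟩ := exists_bornCard_eq_count_top d k
    obtain ⟨P', hP'⟩ := exists_bornCard_eq_count_top d' k'
    rw [← hP _ (le_max_left P P'), ← hP' _ (le_max_right P P'), h]
  | coe l =>
    cases l with
    | zero =>
      -- Only here is positivity needed: bars of length `0` are zero modules, invisible to ranks.
      simp [count_barcode, fun j => (hk j).ne', fun j => (hk' j).ne']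
    | succ l =>
      have h1 := bornCard_eq_count_add d k i l
      have h2 := bornCard_eq_count_add d' k' i l
      rw [h, h] at h1
      push_cast
      omega

theorem GradedDecomposition.barcode_eq {M : Type*} [AddCommGroup M] [Module K[X] M]
    {𝓜 : ℕ → AddSubgroup M} {N N' : ℕ} {d : Fin N → ℕ} {k : Fin N → ℕ∞}
    {d' : Fin N' → ℕ} {k' : Fin N' → ℕ∞} (hk : ∀ j, 0 < k j) (hk' : ∀ j, 0 < k' j)
    (e : GradedDecomposition K 𝓜 d k) (e' : GradedDecomposition K 𝓜 d' k') :
    barcode d k = barcode d' k' :=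
  barcode_eq_of_bornCard_eq hk hk' <| bornCard_eq_of_card_aliveBars_eq fun i p => le_antisymm
    (card_aliveBars_le (e.toLinearEquiv.symm.trans e'.toLinearEquiv)
      (fun _ _ hy => e'.map_mem (e.symm_map_mem hy)) i p)
    (card_aliveBars_le (e'.toLinearEquiv.symm.trans e.toLinearEquiv)
      (fun _ _ hy => e.map_mem (e'.symm_map_mem hy)) i p)

end Uniqueness

end GradedMod

theorem theorem2 {K : Type*} [Field K] {M : Type*} [AddCommGroup M] [Module K[X] M]
    [Module.Finite K[X] M] (𝓜 : ℕ → AddSubgroup M)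
    (h𝓜 : GradedMod.IsGradedModule (GradedMod.canonicalGrading K) 𝓜) :
    (∃ (N : ℕ) (d : Fin N → ℕ) (k : Fin N → ℕ∞),
      (∀ j, 0 < k j) ∧ Nonempty (GradedMod.GradedDecomposition K 𝓜 d k)) ∧
    (∀ (N : ℕ) (d : Fin N → ℕ) (k : Fin N → ℕ∞)
      (N' : ℕ) (d' : Fin N' → ℕ) (k' : Fin N' → ℕ∞),
      (∀ j, 0 < k j) → Nonempty (GradedMod.GradedDecomposition K 𝓜 d k) →
      (∀ j, 0 < k' j) → Nonempty (GradedMod.GradedDecomposition K 𝓜 d' k') →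
      GradedMod.barcode d k = GradedMod.barcode d' k') :=
  ⟨GradedMod.exists_gradedDecomposition h𝓜, fun _ _ _ _ _ _ hk ⟨e⟩ hk' ⟨e'⟩ =>
    GradedMod.GradedDecomposition.barcode_eq hk hk' e e'⟩
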